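/- Let $d\ge 1$ and $N\ge 2$ be integers and let $\varphi:(0,+\infty)\to[0,+\infty)$ be continuous and strictly decreasing with $\lim_{t\to0^+}\varphi(t)=+\infty$. For $x_1,\dots,x_N\in\mathbb R^d$ put $$c(x_1,\dots,x_N)=\sum_{1\le i<j\le N}\varphi(|x_i-x_j|),\qquad \varphi(0):=+\infty .$$ Let $\rho$ be a Borel probability measure on $\mathbb R^d$, let $\mu_\rho(r)=\sup_{x\in\mathbb R^d}\rho(B(x,r))$, where $B(x,r)$ is the open ball, and assume $$\textbf{(A)}\qquad \lim_{r\to0^+}\mu_\rho(r)<\frac1{N(N-1)^2}.$$ Let $u:\mathbb R^d\to\mathbb R$ be a Kantorovich potential, that is, a maximizer of $N\int v\,d\rho$ among all $\rho$-integrable functions $v:\mathbb R^d\to\mathbb R$ such that $v(x_1)+\dots+v(x_N)\le c(x_1,\dots,x_N)$ for all $x_1,\dots,x_N\in\mathbb R^d$, and suppose that $$u(x)=\inf\Big\{c(x,y_2,\dots,y_N)-\sum_{j=2}^N u(y_j)\ :\ y_2,\dots,y_N\in\mathbb R^d\Big\}\qquad\text{for all }x\in\mathbb R^d.$$ Then,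 for every $\beta>0$ with $\mu_\rho(\beta)<\frac1{N(N-1)^2}$ and every $\alpha$ with $0<\alpha<\varphi^{-1}\big(\frac{N^2(N-1)}2\varphi(\beta)\big)$, the function $u$ is bounded and $$\sup_{\mathbb R^d}|u|\le N(N-1)^2\,\varphi\Big(\frac\alpha2\Big).$$ -/

import Mathlib

open MeasureTheory Filter Topology

namespace RepulsiveOT

noncomputable section

/-- The standing assumptions on the interaction `φ : (0, ∞) → [0, ∞)`. Only the values of `φ` on
`(0, ∞)` are ever used. -/
structure IsRepulsive (φ : ℝ → ℝ) : Prop where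
  continuousOn : ContinuousOn φ (Set.Ioi 0)
  nonneg : ∀ t : ℝ, 0 < t → 0 ≤ φ t
  tendsto_zero : Tendsto φ (𝓝[>] 0) atTop
  strictAntiOn : StrictAntiOn φ (Set.Ioi 0)

/-- `φ` extended to distance zero by its limit `+∞`. -/
def extend (φ : ℝ → ℝ) (t : ℝ) : EReal := if 0 < t then (φ t : EReal) else ⊤

/-- The cost `c(x₁, …, xₙ) = ∑_{i < j} φ(|xᵢ - xⱼ|)`; it is `+∞` as soon as two of the points
coincide. -/
def cost (φ : ℝ → ℝ) {d n : ℕ} (x : Fin n → EuclideanSpace ℝ (Fin d)) : EReal :=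
  ∑ i : Fin n, ∑ j ∈ Finset.Ioi i, extend φ (dist (x i) (x j))

/-- The concentration `μ_ρ(r) = sup_x ρ(B(x, r))` of `ρ` at scale `r` (open balls). -/
def concentration {d : ℕ} (ρ : Measure (EuclideanSpace ℝ (Fin d))) (r : ℝ) : ℝ :=
  ⨆ x : EuclideanSpace ℝ (Fin d), ρ.real (Metric.ball x r)

/-- Assumption (A): `lim_{r → 0⁺} μ_ρ(r) < 1 / (N (N - 1)²)`. -/
def SmallConcentration (N : ℕ) {d : ℕ} (ρ : Measure (EuclideanSpace ℝ (Fin d))) : Prop :=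
  ∃ l : ℝ, Tendsto (concentration ρ) (𝓝[>] 0) (𝓝 l) ∧ l < 1 / ((N : ℝ) * ((N : ℝ) - 1) ^ 2)

/-- The admissible functions of the dual problem: `ρ`-integrable `u` with
`u(x₁) + ⋯ + u(x_N) ≤ c(x₁, …, x_N)` everywhere. -/
def dualAdmissible (φ : ℝ → ℝ) (N : ℕ) {d : ℕ} (ρ : Measure (EuclideanSpace ℝ (Fin d))) :
    Set (EuclideanSpace ℝ (Fin d) → ℝ) :=
  {u | Integrable u ρ ∧
    ∀ x : Fin N → EuclideanSpace ℝ (Fin d), ((∑ i, u (x i) : ℝ) : EReal) ≤ cost φ x}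

/-- A Kantorovich potential: a maximizer of `N ∫ u dρ` among the admissible functions. -/
def IsKantorovichPotential (φ : ℝ → ℝ) (N : ℕ) {d : ℕ}
    (ρ : Measure (EuclideanSpace ℝ (Fin d))) (u : EuclideanSpace ℝ (Fin d) → ℝ) : Prop :=
  u ∈ dualAdmissible φ N ρ ∧
    IsMaxOn (fun v : EuclideanSpace ℝ (Fin d) → ℝ => (N : ℝ) * ∫ x, v x ∂ρ)
      (dualAdmissible φ N ρ) u

/-- The `c`-conjugate `x ↦ inf {c(x, y₂, …, y_N) - ∑_{j ≥ 2} u(y_j)}`, with values in `[-∞, ∞]`;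
used for `N ≥ 1` only, the points `y₂, …, y_N` being indexed by `Fin (N - 1)`. -/
def cConjugate (φ : ℝ → ℝ) (N : ℕ) {d : ℕ} (u : EuclideanSpace ℝ (Fin d) → ℝ)
    (x : EuclideanSpace ℝ (Fin d)) : EReal :=
  ⨅ y : Fin (N - 1) → EuclideanSpace ℝ (Fin d),
    cost φ (Fin.cons x y : Fin (N - 1 + 1) → EuclideanSpace ℝ (Fin d)) -
      ((∑ j, u (y j) : ℝ) : EReal)

/-- The inverse `φ⁻¹` of `φ : (0, ∞) → ℝ` on its range. -/
def inverse (φ : ℝ → ℝ) (s : ℝ) : ℝ := Function.invFunOn φ (Set.Ioi 0) s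

end

end RepulsiveOT

namespace RepulsiveOT

open MeasureTheory Filter Topology

variable {φ : ℝ → ℝ} {d n N : ℕ}

/-! The upper bound comes from exchanging points. Since `N * ρ(B(x, β)) < 1`, optimality of `u`
gives, for each `δ > 0`, a configuration `z` outside `B(x, β)` with cost below `∑ u(zᵢ) + δ`
(`exists_almost_tight`). Substituting `x` for each `zₖ` in turn and summing the `N` constraints
(`sum_realCost_update_le`) yields `u x ≤ (N - 1) φ(β)`. Conjugacy and `c ≥ 0` turn this into `u ≥
-(N - 1)² φ(β)`. Finally `α < β` gives `φ(β) ≤ φ(α / 2)`. -/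

lemma IsRepulsive.antitoneOn (hφ : IsRepulsive φ) {s t : ℝ} (hs : 0 < s) (hst : s ≤ t) :
    φ t ≤ φ s :=
  hφ.strictAntiOn.antitoneOn hs (hs.trans_le hst) hst

/-- `φ` need not tend to `0` at infinity, so only values above some `φ β` are known to be attained;
below the range `inverse` is arbitrary. -/
lemma IsRepulsive.exists_eq (hφ : IsRepulsive φ) {β s : ℝ} (hβ : 0 < β) (hs : φ β ≤ s) :
    ∃ t ∈ Set.Ioi (0 : ℝ), φ t = s := by
  obtain ⟨a, ⟨ha0, haβ⟩, has⟩ := ((eventually_mem_set.2 (Ioo_mem_nhdsGT hβ)).and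
    (hφ.tendsto_zero.eventually_ge_atTop s)).exists
  obtain ⟨t, ht, rfl⟩ := intermediate_value_Icc' haβ.le
    (hφ.continuousOn.mono fun x hx => ha0.trans_le hx.1) ⟨hs, has⟩
  exact ⟨t, ha0.trans_le ht.1, rfl⟩

lemma IsRepulsive.inverse_le (hφ : IsRepulsive φ) {β s : ℝ} (hβ : 0 < β) (hs : φ β ≤ s) :
    inverse φ s ≤ β := by
  have hex := hφ.exists_eq hβ hs
  by_contra! h
  have h1 := hφ.strictAntiOn hβ (Function.invFunOn_mem hex) h
  rw [Function.invFunOn_eq hex] at h1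
  exact absurd hs h1.not_ge

lemma extend_nonneg (hφ : IsRepulsive φ) (t : ℝ) : 0 ≤ extend φ t := by
  unfold extend
  split_ifs with h
  · exact_mod_cast hφ.nonneg t h
  · exact le_top

lemma cost_nonneg (hφ : IsRepulsive φ) (x : Fin n → EuclideanSpace ℝ (Fin d)) :
    0 ≤ cost φ x :=
  Finset.sum_nonneg fun _ _ => Finset.sum_nonneg fun _ _ => extend_nonneg hφ _

lemma dist_pos_of_cost_ne_top (hφ : IsRepulsive φ) {x : Fin n → EuclideanSpace ℝ (Fin d)}
    (hx : cost φ x ≠ ⊤) {i j : Fin n} (hij : i < j) : 0 < dist (x i) (x j) := by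
  by_contra h
  refine hx (top_le_iff.1 ?_)
  calc (⊤ : EReal) = extend φ (dist (x i) (x j)) := by simp [extend, h]
    _ ≤ ∑ j ∈ Finset.Ioi i, extend φ (dist (x i) (x j)) :=
        Finset.single_le_sum (f := fun j => extend φ (dist (x i) (x j)))
          (fun _ _ => extend_nonneg hφ _) (Finset.mem_Ioi.2 hij)
    _ ≤ cost φ x :=
        Finset.single_le_sum
          (f := fun i => ∑ j ∈ Finset.Ioi i, extend φ (dist (x i) (x j)))
          (fun _ _ => Finset.sum_nonneg fun _ _ => extend_nonneg hφ _) (Finset.mem_univ i)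

/-- The sum defining the cost, with real values; meaningful for pairwise distinct points. -/
noncomputable def realCost (φ : ℝ → ℝ) (x : Fin n → EuclideanSpace ℝ (Fin d)) : ℝ :=
  ∑ i : Fin n, ∑ j ∈ Finset.Ioi i, φ (dist (x i) (x j))

lemma ereal_coe_sum {ι : Type*} (s : Finset ι) (f : ι → ℝ) :
    ((∑ i ∈ s, f i : ℝ) : EReal) = ∑ i ∈ s, (f i : EReal) :=
  map_sum (⟨⟨Real.toEReal, EReal.coe_zero⟩, EReal.coe_add⟩ : ℝ →+ EReal) f s

lemma cost_eq_realCost {x : Fin n → EuclideanSpace ℝ (Fin d)}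
    (hx : ∀ i j, i < j → 0 < dist (x i) (x j)) : cost φ x = (realCost φ x : EReal) := by
  unfold cost realCost
  rw [ereal_coe_sum]
  refine Finset.sum_congr rfl fun i _ => ?_
  rw [ereal_coe_sum]
  exact Finset.sum_congr rfl fun j hj => by simp [extend, hx i j (Finset.mem_Ioi.1 hj)]

lemma realCost_nonneg (hφ : IsRepulsive φ) {x : Fin n → EuclideanSpace ℝ (Fin d)}
    (hx : ∀ i j, i < j → 0 < dist (x i) (x j)) : 0 ≤ realCost φ x :=
  Finset.sum_nonneg fun _ _ => Finset.sum_nonneg fun _ hj =>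
    hφ.nonneg _ (hx _ _ (Finset.mem_Ioi.1 hj))

lemma sum_sum_Ioi_const (n : ℕ) (a : ℝ) :
    ∑ i : Fin n, ∑ _j ∈ Finset.Ioi i, 2 * a = n * (n - 1) * a := by
  have h : ∀ i : Fin n, ∑ _j ∈ Finset.Ioi i, 2 * a = ((n : ℝ) - 1 - i) * (2 * a) := by
    intro i
    have := i.isLt
    rw [Finset.sum_const, Fin.card_Ioi, nsmul_eq_mul, Nat.cast_sub (by omega),
      Nat.cast_sub (by omega)]
    simp
  have hsum : ∀ m : ℕ, (∑ i ∈ Finset.range m, (i : ℝ)) * 2 = m * (m - 1) := by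
    intro m
    induction m with
    | zero => simp
    | succ k ih => rw [Finset.sum_range_succ, add_mul, ih]; push_cast; ring
  simp_rw [h]
  rw [← Finset.sum_mul, Fin.sum_univ_eq_sum_range (fun i => (n : ℝ) - 1 - i) n,
    Finset.sum_sub_distrib]
  have := hsum n
  simp only [Finset.sum_const, Finset.card_range, nsmul_eq_mul]
  linear_combination (-a) * this

lemma sum_ite_pair {a b : Fin n} (hab : a ≠ b) (s t : ℝ) :
    ∑ j : Fin n, (if a = j ∨ b = j then s else t) = 2 * s + (n - 2) * t := by
  have h : ∀ j : Fin n, (if a = j ∨ b = j then s else t)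
      = t + (if a = j then s - t else 0) + (if b = j then s - t else 0) := by
    intro j
    by_cases h1 : a = j
    · have h2 : b ≠ j := fun h => hab (h1.trans h.symm)
      simp [h1, h2]
    · by_cases h2 : b = j <;> simp [h1, h2]
  simp_rw [h, Finset.sum_add_distrib]
  simp
  ring

/-- Replacing in turn each point of a configuration by a point `x` at distance at least `β` from
all of them. -/
lemma sum_realCost_update_le (hφ : IsRepulsive φ) {β : ℝ} (hβ : 0 < β)
    (z : Fin n → EuclideanSpace ℝ (Fin d)) (x : EuclideanSpace ℝ (Fin d))
    (hzx : ∀ i, β ≤ dist (z i) x) :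
    ∑ k, realCost φ (Function.update z k x)
      ≤ (n - 2) * realCost φ z + n * (n - 1) * φ β := by
  have hk : ∀ k, realCost φ (Function.update z k x) ≤ ∑ i : Fin n, ∑ j ∈ Finset.Ioi i,
      (if i = k ∨ j = k then φ β else φ (dist (z i) (z j))) := by
    intro k
    refine Finset.sum_le_sum fun i _ => Finset.sum_le_sum fun j hj => ?_
    have hij : i < j := Finset.mem_Ioi.1 hj
    by_cases h1 : i = k
    · subst h1
      simp only [Function.update_self, Function.update_of_ne hij.ne', true_or, if_true]
      exact hφ.antitoneOn hβ (dist_comm x (z j) ▸ hzx j)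
    · by_cases h2 : j = k
      · subst h2
        simp only [Function.update_self, Function.update_of_ne hij.ne, or_true, if_true]
        exact hφ.antitoneOn hβ (hzx i)
      · simp [h1, h2]
  -- Each pair `i < j` is hit by exactly two of the `n` replacements, costing at most `φ β` each
  -- time, and is untouched by the other `n - 2`.
  refine (Finset.sum_le_sum fun k _ => hk k).trans_eq ?_
  rw [Finset.sum_comm]
  calc _ = ∑ i : Fin n, ∑ j ∈ Finset.Ioi i, (2 * φ β + (n - 2) * φ (dist (z i) (z j))) := by
        refine Finset.sum_congr rfl fun i _ => ?_
        rw [Finset.sum_comm]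
        exact Finset.sum_congr rfl fun j hj => sum_ite_pair (Finset.mem_Ioi.1 hj).ne _ _
    _ = _ := by
        simp_rw [Finset.sum_add_distrib]
        rw [sum_sum_Ioi_const, add_comm]
        simp_rw [realCost, Finset.mul_sum]

lemma sum_sum_update (u : EuclideanSpace ℝ (Fin d) → ℝ) (z : Fin n → EuclideanSpace ℝ (Fin d))
    (x : EuclideanSpace ℝ (Fin d)) :
    ∑ k, ∑ i, u (Function.update z k x i) = n * u x + (n - 1) * ∑ i, u (z i) := by
  have h : ∀ k, ∑ i, u (Function.update z k x i) = u x + (∑ i, u (z i) - u (z k)) := by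
    intro k
    rw [← Finset.add_sum_erase _ _ (Finset.mem_univ k),
      ← Finset.add_sum_erase _ (fun i => u (z i)) (Finset.mem_univ k)]
    simp only [Function.update_self, add_sub_cancel_left]
    congr 1
    exact Finset.sum_congr rfl fun i hi => by
      rw [Function.update_of_ne (Finset.ne_of_mem_erase hi)]
  simp_rw [h, Finset.sum_add_distrib, Finset.sum_sub_distrib]
  simp
  ring

/-- A Kantorovich potential has almost tight configurations avoiding any set of mass less than
`1 / N`: otherwise lowering the potential on that set and raising it outside improves it. -/
lemma IsKantorovichPotential.exists_almost_tight (hN : 0 < N)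
    {ρ : Measure (EuclideanSpace ℝ (Fin d))} [IsProbabilityMeasure ρ]
    {u : EuclideanSpace ℝ (Fin d) → ℝ} (hu : IsKantorovichPotential φ N ρ u)
    {B : Set (EuclideanSpace ℝ (Fin d))} (hB : MeasurableSet B) (hρB : N * ρ.real B < 1)
    {δ : ℝ} (hδ : 0 < δ) :
    ∃ z : Fin N → EuclideanSpace ℝ (Fin d), (∀ i, z i ∉ B) ∧
      cost φ z < ((∑ i, u (z i) + δ : ℝ) : EReal) := by
  by_contra! hz
  have hN' : (0 : ℝ) < N := by exact_mod_cast hN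
  obtain ⟨⟨hint, hadm⟩, hmax⟩ := hu
  have hind : Integrable (B.indicator fun _ => δ) ρ := (integrable_const δ).indicator hB
  -- The shift `δ / N` raises an `N`-point sum by `δ`; a single point in `B` already cancels this.
  set v : EuclideanSpace ℝ (Fin d) → ℝ := fun x => u x + δ / N - B.indicator (fun _ => δ) x
    with hv
  have hsum : ∀ x : Fin N → EuclideanSpace ℝ (Fin d),
      ∑ i, v (x i) = ∑ i, u (x i) + δ - ∑ i, B.indicator (fun _ => δ) (x i) := by
    intro x
    simp only [hv, Finset.sum_sub_distrib, Finset.sum_add_distrib, Finset.sum_const,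
      Finset.card_univ, Fintype.card_fin, nsmul_eq_mul]
    rw [mul_div_cancel₀ _ hN'.ne']
  have hvadm : v ∈ dualAdmissible φ N ρ := by
    refine ⟨(hint.add (integrable_const _)).sub hind, fun x => ?_⟩
    rw [hsum]
    by_cases hx : ∀ i, x i ∉ B
    · simpa [hx] using hz x hx
    · push Not at hx
      obtain ⟨k, hk⟩ := hx
      refine le_trans (EReal.coe_le_coe_iff.2 ?_) (hadm x)
      have h1 : B.indicator (fun _ => δ) (x k) ≤ ∑ i, B.indicator (fun _ => δ) (x i) :=
        Finset.single_le_sum (f := fun i => B.indicator (fun _ => δ) (x i))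
          (fun i _ => Set.indicator_nonneg (fun _ _ => hδ.le) _) (Finset.mem_univ k)
      rw [Set.indicator_of_mem hk] at h1
      linarith
  have hle : (N : ℝ) * ∫ x, v x ∂ρ ≤ N * ∫ x, u x ∂ρ := hmax hvadm
  have hvint : ∫ x, v x ∂ρ = ∫ x, u x ∂ρ + δ / N - ρ.real B * δ := by
    have hint' : Integrable (fun x => u x + δ / N) ρ := hint.add (integrable_const _)
    rw [hv, integral_sub hint' hind, integral_add hint (integrable_const _),
      integral_indicator_const _ hB]
    simp
  rw [hvint] at hle
  have h2 : (N : ℝ) * (δ / N) = δ := mul_div_cancel₀ _ hN'.ne'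
  -- The gain `δ * (1 - N * ρ(B))` would be positive.
  nlinarith

lemma IsKantorovichPotential.le (hN : 0 < N) (hφ : IsRepulsive φ)
    {ρ : Measure (EuclideanSpace ℝ (Fin d))} [IsProbabilityMeasure ρ]
    {u : EuclideanSpace ℝ (Fin d) → ℝ} (hu : IsKantorovichPotential φ N ρ u) {β : ℝ} (hβ : 0 < β)
    (x : EuclideanSpace ℝ (Fin d)) (hρ : N * ρ.real (Metric.ball x β) < 1) :
    u x ≤ (N - 1) * φ β := by
  have hN' : (0 : ℝ) < N := by exact_mod_cast hN
  refine le_of_forall_pos_le_add fun δ hδ => ?_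
  obtain ⟨z, hzB, hz⟩ := hu.exists_almost_tight hN Metric.isOpen_ball.measurableSet hρ hδ
  have hzx : ∀ i, β ≤ dist (z i) x := fun i => by simpa using hzB i
  have hzpos : ∀ i j, i < j → 0 < dist (z i) (z j) :=
    fun i j => dist_pos_of_cost_ne_top hφ (hz.trans (EReal.coe_lt_top _)).ne
  rw [cost_eq_realCost hzpos, EReal.coe_lt_coe_iff] at hz
  have hupd : ∀ k, ∑ i, u (Function.update z k x i) ≤ realCost φ (Function.update z k x) := by
    intro k
    have h := hu.1.2 (Function.update z k x)
    rwa [cost_eq_realCost, EReal.coe_le_coe_iff] at h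
    intro i j hij
    by_cases h1 : i = k
    · subst h1
      rw [Function.update_self, Function.update_of_ne hij.ne', dist_comm]
      exact hβ.trans_le (hzx j)
    · by_cases h2 : j = k
      · subst h2
        rw [Function.update_self, Function.update_of_ne hij.ne]
        exact hβ.trans_le (hzx i)
      · rw [Function.update_of_ne h1, Function.update_of_ne h2]
        exact hzpos i j hij
  have h1 := (Finset.sum_le_sum fun k (_ : k ∈ Finset.univ) => hupd k).trans
    (sum_realCost_update_le hφ hβ z x hzx)
  rw [sum_sum_update] at h1
  have h2 := realCost_nonneg hφ hzpos
  have h3 : (1 : ℝ) ≤ N := by exact_mod_cast hN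
  -- With `C` the cost of `z`, `(N - 1) ∑ u(zᵢ) ≥ (N - 1)(C - δ)`, which leaves `N u x ≤ N (N - 1) φ
  -- β - C + (N - 1) δ`; then `C ≥ 0` is dropped.
  have h4 := mul_le_mul_of_nonneg_left hz.le (sub_nonneg.2 h3)
  refine le_of_mul_le_mul_left ?_ hN'
  nlinarith

lemma neg_le_cConjugate (hφ : IsRepulsive φ) (hN : 1 ≤ N) {u : EuclideanSpace ℝ (Fin d) → ℝ}
    {M : ℝ} (hM : ∀ x, u x ≤ M) (x : EuclideanSpace ℝ (Fin d)) :
    ((-((N - 1) * M) : ℝ) : EReal) ≤ cConjugate φ N u x := by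
  refine le_iInf fun y => ?_
  have h1 : ∑ j, u (y j) ≤ (N - 1) * M := by
    refine (Finset.sum_le_sum fun j _ => hM (y j)).trans_eq ?_
    simp [Nat.cast_sub hN]
  calc ((-((N - 1) * M) : ℝ) : EReal) ≤ ((0 - ∑ j, u (y j) : ℝ) : EReal) :=
        EReal.coe_le_coe_iff.2 (by linarith)
    _ = 0 - ((∑ j, u (y j) : ℝ) : EReal) := by rw [EReal.coe_sub, EReal.coe_zero]
    _ ≤ _ := EReal.sub_le_sub (cost_nonneg hφ _) le_rfl

lemma real_ball_le_concentration (ρ : Measure (EuclideanSpace ℝ (Fin d)))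
    [IsProbabilityMeasure ρ] (x : EuclideanSpace ℝ (Fin d)) (r : ℝ) :
    ρ.real (Metric.ball x r) ≤ concentration ρ r :=
  le_ciSup (f := fun x => ρ.real (Metric.ball x r))
    ⟨1, by rintro _ ⟨y, rfl⟩; exact measureReal_le_one⟩ x

end RepulsiveOT

theorem mainTheorem4 (d N : ℕ) (hN : 2 ≤ N) (φ : ℝ → ℝ) (hφ : RepulsiveOT.IsRepulsive φ)
    (ρ : MeasureTheory.Measure (EuclideanSpace ℝ (Fin d)))
    [MeasureTheory.IsProbabilityMeasure ρ]
    (hA : RepulsiveOT.SmallConcentration N ρ)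
    (u : EuclideanSpace ℝ (Fin d) → ℝ)
    (hu : RepulsiveOT.IsKantorovichPotential φ N ρ u)
    (hconj : ∀ x, (u x : EReal) = RepulsiveOT.cConjugate φ N u x)
    (β : ℝ) (hβ : 0 < β)
    (hβρ : RepulsiveOT.concentration ρ β < 1 / ((N : ℝ) * ((N : ℝ) - 1) ^ 2))
    (α : ℝ) (hα : 0 < α)
    (hαβ : α < RepulsiveOT.inverse φ ((N : ℝ) ^ 2 * ((N : ℝ) - 1) / 2 * φ β)) :
    ∀ x, |u x| ≤ (N : ℝ) * ((N : ℝ) - 1) ^ 2 * φ (α / 2) := by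
  have hN' : (2 : ℝ) ≤ N := by exact_mod_cast hN
  have hφβ : 0 ≤ φ β := hφ.nonneg β hβ
  have hαβ' : α < β := by
    -- The factor `N² (N - 1) / 2` is at least `1` because `N ≥ 2`.
    refine hαβ.trans_le (hφ.inverse_le hβ (le_mul_of_one_le_left hφβ ?_))
    nlinarith
  have hφα : φ β ≤ φ (α / 2) := hφ.antitoneOn (half_pos hα) (by linarith)
  have hM : ∀ x, u x ≤ (N - 1) * φ β := by
    intro x
    refine hu.le (by omega) hφ hβ x ?_
    have h1 : ρ.real (Metric.ball x β) < 1 / ((N : ℝ) * ((N : ℝ) - 1) ^ 2) :=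
      (RepulsiveOT.real_ball_le_concentration ρ x β).trans_lt hβρ
    have h2 : 1 / ((N : ℝ) * ((N : ℝ) - 1) ^ 2) ≤ 1 / N :=
      one_div_le_one_div_of_le (by linarith) (by nlinarith)
    calc (N : ℝ) * ρ.real (Metric.ball x β) < N * (1 / N) :=
          mul_lt_mul_of_pos_left (h1.trans_le h2) (by linarith)
      _ = 1 := mul_one_div_cancel (by linarith)
  have hsq : (N - 1) ^ 2 * φ β ≤ (N : ℝ) * ((N : ℝ) - 1) ^ 2 * φ (α / 2) := by
    have h : (N - 1 : ℝ) ^ 2 ≤ N * (N - 1) ^ 2 := le_mul_of_one_le_left (sq_nonneg _) (by linarith)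
    exact mul_le_mul h hφα hφβ ((sq_nonneg _).trans h)
  intro x
  have hlow := RepulsiveOT.neg_le_cConjugate hφ (one_le_two.trans hN) hM x
  rw [← hconj x, EReal.coe_le_coe_iff] at hlow
  have hup : (N - 1) * φ β ≤ (N - 1) ^ 2 * φ β :=
    mul_le_mul_of_nonneg_right (by nlinarith) hφβ
  exact abs_le.2 ⟨by linarith, (hM x).trans (hup.trans hsq)⟩
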